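/- **Theorem 1.1.** For $N\in\mathbb N$ let $\mathcal Q_N=\{-1,1\}^N$, let $T$ be the adjacency matrix of the Hamming cube $\mathcal Q_N$, i.e. $T_{\sigma\tau}=1$ if $\sigma$ and $\tau$ differ in exactly one coordinate and $T_{\sigma\tau}=0$ otherwise, and let $|-\rangle=2^{-N/2}\sum_{\sigma\in\mathcal Q_N}|\sigma\rangle$ be the normalized flat vector. On a probability space $(\Omega,\mathbb P)$ let, for every $N$, the REM potential $U=U_N$ on $\mathcal Q_N$ be given: the values $U_N(\sigma)$, $\sigma\in\mathcal Q_N$, are independent normal random variables with mean $0$ and variance $N$ (nothing is assumed on the joint law of $U_N$ for different $N$), and $U_N$ acts on functions on $\mathcal Q_N$ by multiplication. For $t>0$, $\lambda\ge 0$ and $s\in\mathbb R$ define the scaled cumulant generating function $$\theta_N(t,\lambda,s)=\frac1{Nt}\ln\,\langle -|\,e^{t(e^{-s}T-N\mathbb 1-\lambda U_N)}\,|-\rangle .$$ Then, for any $t>0$, $\lambda\ge 0$ and $s\in\mathbb R$, $\mathbb P$-almost surely $$\lim_{N\to\infty}\theta_N(t,\lambda,s)=\max\{e^{-s},\,t^{-1}p_{\mathrm{REM}}(t\lambda)\}-1,$$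 where, with $\beta_c=\sqrt{2\ln 2}$, $$p_{\mathrm{REM}}(\beta)=\begin{cases}\beta^2/2,&\beta\le\beta_c,\\ \beta\beta_c-\ln 2,&\beta>\beta_c.\end{cases}$$ -/

import Mathlib

open MeasureTheory ProbabilityTheory Filter Topology

noncomputable section

namespace REMTrajectory

/-- The configuration space of `N` Ising spins, `{-1, 1}^N`; the unit group of `ℤ` is `{-1, 1}`. -/
abbrev Cube (N : ℕ) : Type := Fin N → ℤˣ

/-- The adjacency matrix `T` of the Hamming cube: its entry is `1` exactly for pairs of
configurations that differ in a single spin. -/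
def adjacency (N : ℕ) : Matrix (Cube N) (Cube N) ℝ :=
  Matrix.of fun σ τ => if hammingDist σ τ = 1 then 1 else 0

/-- The normalized flat vector `2^{-N/2} ∑_σ |σ⟩`. -/
def flat (N : ℕ) : Cube N → ℝ := fun _ => 1 / Real.sqrt (2 ^ N)

/-- The tilted generator `e^{-s} T - N - lam U`, where the energy function `U` acts by
multiplication. -/
def generator (N : ℕ) (U : Cube N → ℝ) (lam s : ℝ) : Matrix (Cube N) (Cube N) ℝ :=
  Real.exp (-s) • adjacency N - (N : ℝ) • (1 : Matrix (Cube N) (Cube N) ℝ)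
    - lam • Matrix.diagonal U

/-- The moment generating function: the matrix element in the flat vector of the matrix
exponential `e^{t (e^{-s} T - N - lam U)}`. -/
def Z (N : ℕ) (U : Cube N → ℝ) (t lam s : ℝ) : ℝ :=
  flat N ⬝ᵥ (Matrix.mulVec (NormedSpace.exp (t • generator N U lam s)) (flat N))

/-- The scaled cumulant generating function `(N t)⁻¹ ln Z`. -/
def scgf (N : ℕ) (U : Cube N → ℝ) (t lam s : ℝ) : ℝ :=
  1 / ((N : ℝ) * t) * Real.log (Z N U t lam s)

/-- The critical inverse temperature `β_c = √(2 ln 2)`. -/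
def betaC : ℝ := Real.sqrt (2 * Real.log 2)

/-- The pressure of the REM. -/
def pREM (β : ℝ) : ℝ :=
  if β ≤ betaC then β ^ 2 / 2 else β * betaC - Real.log 2

/-- `U` is a REM potential on the `N`-cube: the values `U σ` are independent centred Gaussian
random variables of variance `N`. -/
structure IsREM {Ω : Type*} [MeasurableSpace Ω] (P : Measure Ω) (N : ℕ)
    (U : Cube N → Ω → ℝ) : Prop where
  hasLaw : ∀ σ, HasLaw (U σ) (gaussianReal 0 (N : NNReal)) P
  indep : iIndepFun U P

end REMTrajectory

end

/-! With g = t e^{-s}, b = tλ and G = -U, the moment generating function is e^{-tN} 2^{-N} times the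
sum of all entries of exp(gT + bG) (`Z_eq`). The claim is therefore that this sum grows like 2^N
e^{N max(g, p_REM(b))}.

Lower bound: the sum is monotone in the entries of the matrix, so dropping T leaves the classical
partition function Σ e^{bG}. On the other hand, the indicator of the configurations where G is not
very negative is a subsolution at energy close to gN (`le_expMass_hopping`).

Upper bound: large values of G are sparse. Almost surely, for large N, every configuration has at
most ηN neighbours with G > εN (`ae_eventually_nbrCount_le`), since the at most 4^N choices of a
centre and a set of directions lose against a probability e^{-cN²}. Hence T barely couples the
wells, and a function equal to 1 off the wells and to a constant on them is a supersolution at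
energy max(depth, gN) + dN. Inserting the wells one at a time, each costs only its own Boltzmann
factor up to negligible factors (`expMass_add_single_le`, `expMass_hopping_le_sum`), so gT + bG has
mass at most 2^N e^{gN} + Σ e^{bG} to exponential accuracy.

The classical sum is controlled by its first moment and the maximum of G from above, and by a second
moment bound on level sets from below. -/

namespace REMTrajectory

/-! ### Exponentials of matrices with nonnegative off-diagonal entries. -/

section MatrixExp

open Matrix

variable {ι : Type*} [Fintype ι]

theorem mulVec_mono {A : Matrix ι ι ℝ} (hA : ∀ i j, 0 ≤ A i j) {φ ψ : ι → ℝ} (h : φ ≤ ψ) :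
    A *ᵥ φ ≤ A *ᵥ ψ := fun i =>
  Finset.sum_le_sum fun j _ => mul_le_mul_of_nonneg_left (h j) (hA i j)

variable [DecidableEq ι]

theorem hasSum_exp_apply (A : Matrix ι ι ℝ) (i j : ι) :
    HasSum (fun n : ℕ => (n.factorial : ℝ)⁻¹ * (A ^ n) i j) (NormedSpace.exp A i j) := by
  have h : HasSum (fun n : ℕ => (n.factorial : ℝ)⁻¹ • A ^ n) (NormedSpace.exp A) := by
    open scoped Norms.Operator in
    exact NormedSpace.exp_series_hasSum_exp' (𝕂 := ℝ) A
  have h' := Pi.hasSum.1 (Pi.hasSum.1 h i) j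
  simpa using h'

theorem hasSum_exp_mulVec (A : Matrix ι ι ℝ) (φ : ι → ℝ) (i : ι) :
    HasSum (fun n : ℕ => (n.factorial : ℝ)⁻¹ * (A ^ n *ᵥ φ) i) ((NormedSpace.exp A *ᵥ φ) i) := by
  have h : HasSum (fun n : ℕ => ∑ j, (n.factorial : ℝ)⁻¹ * (A ^ n) i j * φ j)
      (∑ j, NormedSpace.exp A i j * φ j) :=
    hasSum_sum fun j _ => (hasSum_exp_apply A i j).mul_right (φ j)
  simpa only [mulVec, dotProduct, Finset.mul_sum, mul_assoc] using h

theorem hasSum_real_exp (x : ℝ) :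
    HasSum (fun n : ℕ => (n.factorial : ℝ)⁻¹ * x ^ n) (Real.exp x) := by
  have h := NormedSpace.exp_series_hasSum_exp' (𝕂 := ℝ) x
  rw [← Real.exp_eq_exp_ℝ] at h
  simpa using h

theorem exp_add_smul_one (A : Matrix ι ι ℝ) (c : ℝ) :
    NormedSpace.exp (A + c • (1 : Matrix ι ι ℝ)) = Real.exp c • NormedSpace.exp A := by
  have hc : NormedSpace.exp (c • (1 : Matrix ι ι ℝ)) = Real.exp c • (1 : Matrix ι ι ℝ) := by
    rw [Matrix.smul_one_eq_diagonal, Matrix.exp_diagonal, Matrix.smul_one_eq_diagonal]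
    congr 1
    ext i
    rw [Pi.coe_exp, Real.exp_eq_exp_ℝ]
  rw [Matrix.exp_add_of_commute _ _ ((Commute.one_right A).smul_right c), hc]
  simp

theorem pow_apply_nonneg {A : Matrix ι ι ℝ} (hA : ∀ i j, 0 ≤ A i j) (n : ℕ) (i j : ι) :
    0 ≤ (A ^ n) i j := by
  induction n generalizing i j with
  | zero => simp only [pow_zero, Matrix.one_apply]; split_ifs <;> norm_num
  | succ n ih =>
    rw [pow_succ, Matrix.mul_apply]
    exact Finset.sum_nonneg fun k _ => mul_nonneg (ih i k) (hA k j)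

theorem pow_apply_mono {A B : Matrix ι ι ℝ} (hA : ∀ i j, 0 ≤ A i j)
    (hAB : ∀ i j, A i j ≤ B i j) (n : ℕ) (i j : ι) : (A ^ n) i j ≤ (B ^ n) i j := by
  induction n generalizing i j with
  | zero => simp
  | succ n ih =>
    rw [pow_succ, pow_succ, Matrix.mul_apply, Matrix.mul_apply]
    exact Finset.sum_le_sum fun k _ => mul_le_mul (ih i k) (hAB k j) (hA k j)
      ((pow_apply_nonneg hA n i k).trans (ih i k))

theorem pow_mulVec_le {A : Matrix ι ι ℝ} (hA : ∀ i j, 0 ≤ A i j) {φ : ι → ℝ} {E : ℝ}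
    (hE : 0 ≤ E) (h : A *ᵥ φ ≤ E • φ) (n : ℕ) : A ^ n *ᵥ φ ≤ E ^ n • φ := by
  induction n with
  | zero => simp
  | succ n ih =>
    rw [pow_succ', ← mulVec_mulVec]
    refine (mulVec_mono hA ih).trans ?_
    rw [mulVec_smul, pow_succ, mul_smul]
    exact smul_le_smul_of_nonneg_left h (pow_nonneg hE n)

theorem le_pow_mulVec {A : Matrix ι ι ℝ} (hA : ∀ i j, 0 ≤ A i j) {φ : ι → ℝ} {E : ℝ}
    (hE : 0 ≤ E) (h : E • φ ≤ A *ᵥ φ) (n : ℕ) : E ^ n • φ ≤ A ^ n *ᵥ φ := by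
  induction n with
  | zero => simp
  | succ n ih =>
    rw [pow_succ' A, ← mulVec_mulVec]
    refine le_trans ?_ (mulVec_mono hA ih)
    rw [mulVec_smul, pow_succ, mul_smul]
    exact smul_le_smul_of_nonneg_left h (pow_nonneg hE n)

/-- A multiple of the identity only rescales the exponential, so diagonal entries and energies of
any sign reduce to the nonnegative case, where the power series compare term by term. -/
theorem exists_shift_nonneg {A : Matrix ι ι ℝ} (hA : ∀ i j, i ≠ j → 0 ≤ A i j) (E : ℝ) :
    ∃ c : ℝ, 0 ≤ E + c ∧ ∀ i j, 0 ≤ (A + c • (1 : Matrix ι ι ℝ)) i j := by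
  have hs : 0 ≤ ∑ i, |A i i| := Finset.sum_nonneg fun i _ => abs_nonneg _
  refine ⟨|E| + ∑ i, |A i i|, by linarith [neg_abs_le E], fun i j => ?_⟩
  by_cases h : i = j
  · subst h
    have h1 : |A i i| ≤ ∑ i, |A i i| :=
      Finset.single_le_sum (f := fun i => |A i i|) (fun i _ => abs_nonneg _) (Finset.mem_univ i)
    simp only [Matrix.add_apply, Matrix.smul_apply, one_apply_eq, smul_eq_mul, mul_one]
    linarith [abs_nonneg E, neg_abs_le (A i i)]
  · simpa [Matrix.one_apply_ne h] using hA i j h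

theorem exp_apply_mono {A B : Matrix ι ι ℝ} (hA : ∀ i j, i ≠ j → 0 ≤ A i j)
    (hAB : ∀ i j, A i j ≤ B i j) (i j : ι) :
    NormedSpace.exp A i j ≤ NormedSpace.exp B i j := by
  obtain ⟨c, -, hc⟩ := exists_shift_nonneg hA 0
  have h : NormedSpace.exp (A + c • (1 : Matrix ι ι ℝ)) i j
      ≤ NormedSpace.exp (B + c • (1 : Matrix ι ι ℝ)) i j := by
    refine hasSum_le (fun n => ?_) (hasSum_exp_apply _ i j) (hasSum_exp_apply _ i j)
    refine mul_le_mul_of_nonneg_left (pow_apply_mono hc (fun i j => ?_) n i j) (by positivity)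
    simpa using hAB i j
  simpa [exp_add_smul_one, Real.exp_pos] using h

theorem le_exp_mulVec {A : Matrix ι ι ℝ} (hA : ∀ i j, i ≠ j → 0 ≤ A i j) {φ : ι → ℝ} {E : ℝ}
    (h : E • φ ≤ A *ᵥ φ) : Real.exp E • φ ≤ NormedSpace.exp A *ᵥ φ := by
  obtain ⟨c, hE, hc⟩ := exists_shift_nonneg hA E
  have h1 : (E + c) • φ ≤ (A + c • (1 : Matrix ι ι ℝ)) *ᵥ φ := by
    rw [add_mulVec, smul_mulVec, one_mulVec, add_smul]
    exact add_le_add_left h _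
  have h2 : Real.exp (E + c) • φ ≤ NormedSpace.exp (A + c • (1 : Matrix ι ι ℝ)) *ᵥ φ := by
    intro i
    refine hasSum_le (fun n => ?_) ((hasSum_real_exp (E + c)).mul_right (φ i))
      (hasSum_exp_mulVec _ φ i)
    rw [mul_assoc]
    exact mul_le_mul_of_nonneg_left (le_pow_mulVec hc hE h1 n i) (by positivity)
  rw [exp_add_smul_one, smul_mulVec, Real.exp_add, mul_comm, mul_smul] at h2
  exact (smul_le_smul_iff_of_pos_left (Real.exp_pos c)).1 h2

/-- The sum of all entries of the exponential of a matrix. -/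
noncomputable def expMass (A : Matrix ι ι ℝ) : ℝ := ∑ i, (NormedSpace.exp A *ᵥ 1) i

theorem hasSum_expMass (A : Matrix ι ι ℝ) :
    HasSum (fun n : ℕ => (n.factorial : ℝ)⁻¹ * ∑ i, (A ^ n *ᵥ 1) i) (expMass A) := by
  have h := hasSum_sum (s := Finset.univ) fun i _ => hasSum_exp_mulVec A 1 i
  simpa only [expMass, Finset.mul_sum] using h

theorem expMass_mono {A B : Matrix ι ι ℝ} (hA : ∀ i j, i ≠ j → 0 ≤ A i j)
    (hAB : ∀ i j, A i j ≤ B i j) : expMass A ≤ expMass B := by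
  refine Finset.sum_le_sum fun i _ => Finset.sum_le_sum fun j _ => ?_
  simpa using exp_apply_mono hA hAB i j

theorem expMass_add_smul_one (A : Matrix ι ι ℝ) (c : ℝ) :
    expMass (A + c • (1 : Matrix ι ι ℝ)) = Real.exp c * expMass A := by
  simp [expMass, exp_add_smul_one, smul_mulVec, Finset.mul_sum]

theorem expMass_diagonal (v : ι → ℝ) : expMass (diagonal v) = ∑ i, Real.exp (v i) := by
  simp [expMass, exp_diagonal, mulVec_diagonal, Pi.coe_exp, Real.exp_eq_exp_ℝ]

theorem expMass_le_of_mulVec_one_le {A : Matrix ι ι ℝ} (hA : ∀ i j, 0 ≤ A i j) {E : ℝ}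
    (hE : 0 ≤ E) (h : A *ᵥ 1 ≤ E • 1) : expMass A ≤ Fintype.card ι * Real.exp E := by
  refine hasSum_le (fun n => ?_) (hasSum_expMass A) ((hasSum_real_exp E).mul_left _)
  rw [mul_left_comm]
  refine mul_le_mul_of_nonneg_left ?_ (by positivity)
  calc ∑ i, (A ^ n *ᵥ 1) i ≤ ∑ _i : ι, E ^ n :=
        Finset.sum_le_sum fun i _ => by simpa using pow_mulVec_le hA hE h n i
    _ = Fintype.card ι * E ^ n := by simp

/-- The exponential series differentiated term by term; the factor `n` kills the term in which `n -
1` truncates. It sums the errors in `expMass_add_single_le`. -/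
theorem hasSum_real_exp_deriv (x : ℝ) :
    HasSum (fun n : ℕ => (n.factorial : ℝ)⁻¹ * (n * x ^ (n - 1))) (Real.exp x) := by
  rw [← hasSum_nat_add_iff' 1]
  simp only [Finset.range_one, Finset.sum_singleton, Nat.cast_zero, zero_mul, mul_zero, sub_zero]
  suffices h : (fun n : ℕ => ((n + 1).factorial : ℝ)⁻¹ * (((n + 1 : ℕ) : ℝ) * x ^ (n + 1 - 1)))
      = fun n => (n.factorial : ℝ)⁻¹ * x ^ n by
    rw [h]
    exact hasSum_real_exp x
  ext n
  have : ((n : ℝ) + 1) ≠ 0 := by positivity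
  rw [Nat.factorial_succ]
  push_cast
  field_simp

/-- Adding a single nonnegative diagonal entry `v` at `x` to a nonnegative symmetric matrix `B`
increases the mass of the exponential by at most `v a² e^E`, if there is a supersolution `φ` with
values in `[1, a]` at energy `E`. -/
theorem expMass_add_single_le {A B : Matrix ι ι ℝ} (hB : ∀ i j, 0 ≤ B i j) (hA : A.IsSymm)
    {x : ι} {v : ℝ} (hv : 0 ≤ v) (hAB : A = B + diagonal (Pi.single x v)) {φ : ι → ℝ} {a E : ℝ}
    (hE : 0 ≤ E) (h1 : 1 ≤ φ) (ha : ∀ i, φ i ≤ a) (h : A *ᵥ φ ≤ E • φ) :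
    expMass A ≤ expMass B + v * a ^ 2 * Real.exp E := by
  have hBA : ∀ i j, B i j ≤ A i j := by
    intro i j
    rw [hAB, Matrix.add_apply, le_add_iff_nonneg_right, diagonal_apply]
    split_ifs
    · exact (Pi.single_nonneg (i := x).2 hv : (0 : ι → ℝ) ≤ Pi.single x v) i
    · exact le_rfl
  have hA0 : ∀ i j, 0 ≤ A i j := fun i j => (hB i j).trans (hBA i j)
  have hφ : 0 ≤ φ := zero_le_one.trans h1
  have hBφ : B *ᵥ φ ≤ E • φ := fun i =>
    (Finset.sum_le_sum fun j _ => mul_le_mul_of_nonneg_right (hBA i j) (hφ j)).trans (h i)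
  have ha0 : 0 ≤ a := (hφ x).trans (ha x)
  have bound : ∀ {C : Matrix ι ι ℝ}, (∀ i j, 0 ≤ C i j) → C *ᵥ φ ≤ E • φ → ∀ n,
      (C ^ n *ᵥ 1) x ≤ E ^ n * a := fun hC hCφ n =>
    (mulVec_mono (pow_apply_nonneg hC n) h1 x).trans ((pow_mulVec_le hC hE hCφ n x).trans
      (mul_le_mul_of_nonneg_left (ha x) (pow_nonneg hE n)))
  -- Telescoping: factors `A` are traded for `B` one at a time, at the price of A^n D B^k with D the
  -- diagonal perturbation. The extra exponent `k` lets the induction close.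
  have key : ∀ n k : ℕ, ∑ i, ((A ^ n * B ^ k) *ᵥ 1) i
      ≤ ∑ i, (B ^ (n + k) *ᵥ 1) i + v * a ^ 2 * (n * E ^ (n + k - 1)) := by
    intro n
    induction n with
    | zero => intro k; simp
    | succ n ih =>
      intro k
      have e1 : A ^ (n + 1) * B ^ k
          = A ^ n * B ^ (k + 1) + A ^ n * (diagonal (Pi.single x v) * B ^ k) := by
        rw [pow_succ, mul_assoc]
        nth_rw 2 [hAB]
        rw [add_mul, mul_add, ← pow_succ']
      -- The perturbation lives at the single site `x`, so by symmetry of `A` the entry sum factors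
      -- into the row sums of A^n and B^k at `x`, each bounded through the supersolution.
      have e2 : ∑ i, ((A ^ n * (diagonal (Pi.single x v) * B ^ k)) *ᵥ 1) i
          = (A ^ n *ᵥ 1) x * (v * (B ^ k *ᵥ 1) x) := by
        have hs : ∀ i, (A ^ n) i x = (A ^ n) x i := fun i => (hA.pow n).apply x i
        have : ∀ i, ((A ^ n * (diagonal (Pi.single x v) * B ^ k)) *ᵥ 1) i
            = (A ^ n) x i * (v * (B ^ k *ᵥ 1) x) := by
          intro i
          rw [← mulVec_mulVec, ← mulVec_mulVec, ← hs]
          change ∑ j, (A ^ n) i j * (diagonal (Pi.single x v) *ᵥ (B ^ k *ᵥ 1)) j = _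
          rw [Finset.sum_eq_single x]
          · rw [mulVec_diagonal, Pi.single_eq_same]
          · intro j _ hj
            rw [mulVec_diagonal, Pi.single_eq_of_ne hj, zero_mul, mul_zero]
          · simp
        simp only [this, ← Finset.sum_mul]
        simp [mulVec, dotProduct]
      have e3 : (A ^ n *ᵥ 1) x * (v * (B ^ k *ᵥ 1) x) ≤ (E ^ n * a) * (v * (E ^ k * a)) := by
        have hBk : 0 ≤ (B ^ k *ᵥ 1) x :=
          Finset.sum_nonneg fun j _ => by simpa using pow_apply_nonneg hB k x j
        exact mul_le_mul (bound hA0 h n) (mul_le_mul_of_nonneg_left (bound hB hBφ k) hv)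
          (mul_nonneg hv hBk) (by positivity)
      have e4 := ih (k + 1)
      have e5 : n + (k + 1) - 1 = n + k := by omega
      have e6 : n + 1 + k - 1 = n + k := by omega
      have e7 : n + (k + 1) = n + 1 + k := by omega
      rw [e5, e7] at e4
      rw [e1, e6]
      simp only [add_mulVec, Pi.add_apply, Finset.sum_add_distrib]
      rw [e2]
      push_cast
      calc _ ≤ _ := add_le_add e4 e3
        _ = _ := by ring
  refine hasSum_le (fun n => ?_) (hasSum_expMass A)
    ((hasSum_expMass B).add ((hasSum_real_exp_deriv E).mul_left (v * a ^ 2)))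
  have := mul_le_mul_of_nonneg_left (key n 0) (by positivity : (0 : ℝ) ≤ (n.factorial : ℝ)⁻¹)
  simp only [pow_zero, mul_one, add_zero] at this
  linarith

end MatrixExp

/-! ### The Hamming cube and deterministic bounds for g T + v. -/

section Cube

open Matrix

variable {N : ℕ}

/-- The configuration `σ` with the spin `i` reversed. -/
def flip (σ : Cube N) (i : Fin N) : Cube N := Function.update σ i (-σ i)

theorem flip_flip (σ : Cube N) (i : Fin N) : flip (flip σ i) i = σ := by
  simp [flip]

theorem units_int_ne_neg (u : ℤˣ) : -u ≠ u := by
  rcases Int.units_eq_one_or u with rfl | rfl <;> decide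

theorem flip_injective (σ : Cube N) : Function.Injective (flip σ) := by
  intro i j h
  by_contra hij
  have h' := congrFun h i
  simp only [flip, Function.update_self, Function.update_of_ne hij] at h'
  exact units_int_ne_neg _ h'

theorem hammingDist_eq_one_iff (σ τ : Cube N) : hammingDist σ τ = 1 ↔ ∃ i, flip σ i = τ := by
  rw [hammingDist, Finset.card_eq_one]
  constructor
  · rintro ⟨i, hi⟩
    refine ⟨i, funext fun j => ?_⟩
    have hj := Finset.ext_iff.1 hi j
    simp only [Finset.mem_filter, Finset.mem_univ, true_and, Finset.mem_singleton] at hj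
    by_cases h : j = i
    · subst h
      have hne : τ j ≠ σ j := (hj.2 rfl).symm
      rw [flip, Function.update_self]
      exact (Int.units_ne_iff_eq_neg.1 hne).symm
    · rw [flip, Function.update_of_ne h]
      by_contra hc
      exact h (hj.1 hc)
  · rintro ⟨i, rfl⟩
    refine ⟨i, ?_⟩
    ext j
    rw [Finset.mem_filter_univ, Finset.mem_singleton]
    by_cases h : j = i
    · subst h
      simp [flip, (units_int_ne_neg (σ j)).symm]
    · simp [flip, h]

theorem adjacency_mulVec (φ : Cube N → ℝ) (σ : Cube N) :
    (adjacency N *ᵥ φ) σ = ∑ i, φ (flip σ i) := by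
  have h : Finset.univ.filter (fun τ => hammingDist σ τ = 1)
      = Finset.univ.image (flip σ) := by
    ext τ
    simp [hammingDist_eq_one_iff]
  simp only [mulVec, dotProduct, adjacency, of_apply, ite_mul, one_mul, zero_mul]
  rw [← Finset.sum_filter, h, Finset.sum_image fun i _ j _ hij => flip_injective σ hij]

theorem adjacency_nonneg (σ τ : Cube N) : 0 ≤ adjacency N σ τ := by
  simp only [adjacency, of_apply]; split_ifs <;> norm_num

theorem adjacency_isSymm : (adjacency N).IsSymm := by
  ext σ τ
  simp [adjacency, hammingDist_comm]

theorem card_cube : (Fintype.card (Cube N) : ℝ) = 2 ^ N := by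
  simp

/-- The number of neighbours of `σ` in `L`. -/
def nbrCount (L : Finset (Cube N)) (σ : Cube N) : ℕ :=
  (Finset.univ.filter fun i => flip σ i ∈ L).card

/-- Double counting: in each fixed direction the flip is a bijection of the cube. -/
theorem sum_nbrCount (L : Finset (Cube N)) : ∑ σ, nbrCount L σ = N * L.card := by
  have h : ∀ i : Fin N, ∑ σ : Cube N, (if flip σ i ∈ L then 1 else 0) = L.card := by
    intro i
    have := Equiv.sum_comp (Function.Involutive.toPerm (fun σ : Cube N => flip σ i)
      (fun σ => flip_flip σ i)) (fun τ => if τ ∈ L then 1 else 0)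
    rw [Finset.sum_ite_mem, Finset.univ_inter, Finset.sum_const, smul_eq_mul, mul_one] at this
    exact this
  simp only [nbrCount, Finset.card_filter]
  rw [Finset.sum_comm]
  simp [h]

theorem sum_nbr_ite (L : Finset (Cube N)) (σ : Cube N) (a b : ℝ) :
    ∑ i, (if flip σ i ∈ L then a else b) = N * b + (a - b) * nbrCount L σ := by
  have h : ∀ i, (if flip σ i ∈ L then a else b)
      = b + (a - b) * (if flip σ i ∈ L then 1 else 0) := by
    intro i; split_ifs <;> ring
  simp only [h, Finset.sum_add_distrib, ← Finset.mul_sum]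
  simp [nbrCount]

/-- The Schrödinger-type operator `g T + v` on the cube. -/
def hopping (g : ℝ) (v : Cube N → ℝ) : Matrix (Cube N) (Cube N) ℝ :=
  g • adjacency N + diagonal v

theorem hopping_mulVec (g : ℝ) (v φ : Cube N → ℝ) (σ : Cube N) :
    (hopping g v *ᵥ φ) σ = g * ∑ i, φ (flip σ i) + v σ * φ σ := by
  rw [hopping, add_mulVec, Pi.add_apply, smul_mulVec, Pi.smul_apply, adjacency_mulVec,
    mulVec_diagonal, smul_eq_mul]

theorem hopping_isSymm (g : ℝ) (v : Cube N → ℝ) : (hopping g v).IsSymm :=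
  (adjacency_isSymm.smul g).add (isSymm_diagonal v)

theorem hopping_offDiag_nonneg {g : ℝ} (hg : 0 ≤ g) (v : Cube N → ℝ) (σ τ : Cube N)
    (h : σ ≠ τ) : 0 ≤ hopping g v σ τ := by
  simpa [hopping, diagonal_apply_ne _ h] using mul_nonneg hg (adjacency_nonneg σ τ)

theorem hopping_nonneg {g : ℝ} (hg : 0 ≤ g) {v : Cube N → ℝ} (hv : 0 ≤ v) (σ τ : Cube N) :
    0 ≤ hopping g v σ τ := by
  refine add_nonneg (mul_nonneg hg (adjacency_nonneg σ τ)) ?_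
  rw [diagonal_apply]
  split_ifs
  exacts [hv σ, le_rfl]

theorem hopping_mono {g : ℝ} {v w : Cube N → ℝ} (h : v ≤ w) (σ τ : Cube N) :
    hopping g v σ τ ≤ hopping g w σ τ := by
  refine add_le_add_right ?_ _
  rw [diagonal_apply, diagonal_apply]
  split_ifs
  exacts [h σ, le_rfl]

theorem hopping_add_const (g c : ℝ) (v : Cube N → ℝ) :
    hopping g (fun σ => v σ + c) = hopping g v + c • (1 : Matrix (Cube N) (Cube N) ℝ) := by
  rw [hopping, hopping, add_assoc, smul_one_eq_diagonal, diagonal_add]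

/-- If every configuration has few neighbours in `L`, then the function equal to `1 + g / d` on `L`
and to `1` off `L` is a supersolution of `g T + v` for all `v` supported on `L`. -/
theorem hopping_supersolution {g d c : ℝ} (hg : 0 ≤ g) (hd : 0 < d) {L : Finset (Cube N)}
    (hL : ∀ σ, g ^ 2 * nbrCount L σ ≤ d ^ 2 * N) {v : Cube N → ℝ} (hvc : ∀ σ, v σ ≤ c)
    (hvL : ∀ σ, σ ∉ L → v σ ≤ 0) :
    hopping g v *ᵥ (fun σ => if σ ∈ L then 1 + g / d else 1)
      ≤ (max c (g * N) + d * N) • fun σ => if σ ∈ L then 1 + g / d else 1 := by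
  intro σ
  rw [hopping_mulVec, sum_nbr_ite, Pi.smul_apply, smul_eq_mul]
  have h1 : g * (N * 1 + (1 + g / d - 1) * nbrCount L σ) ≤ g * N + d * N := by
    have h2 : g * ((g / d) * nbrCount L σ) ≤ d * N := by
      have : g * ((g / d) * nbrCount L σ) = (g ^ 2 * nbrCount L σ) / d := by field_simp
      rw [this, div_le_iff₀ hd]
      calc _ ≤ d ^ 2 * N := hL σ
        _ = _ := by ring
    calc _ = g * N + g * ((g / d) * nbrCount L σ) := by ring
      _ ≤ _ := by linarith
  split_ifs with hσ
  · have h3 : v σ * (1 + g / d) ≤ max c (g * N) * (1 + g / d) :=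
      mul_le_mul_of_nonneg_right ((hvc σ).trans (le_max_left _ _)) (by positivity)
    -- The value 1 + g/d is chosen for this identity: on a well, the surplus energy dN pays for the
    -- whole hopping term (g + d)N.
    have h4 : d * N * (1 + g / d) = d * N + g * N := by field_simp
    linarith
  · have := hvL σ hσ
    have := le_max_right c (g * N)
    linarith

theorem expMass_hopping_zero_le {g : ℝ} (hg : 0 ≤ g) :
    expMass (hopping g (0 : Cube N → ℝ)) ≤ 2 ^ N * Real.exp (g * N) := by
  rw [← card_cube]
  refine expMass_le_of_mulVec_one_le (hopping_nonneg hg le_rfl) (by positivity) fun σ => ?_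
  rw [hopping_mulVec]
  simp

/-- Wells supported on a set `L` that is sparse around every configuration contribute to the mass
of the exponential at most the sum of their individual Boltzmann factors. -/
theorem expMass_hopping_le_sum {g d : ℝ} (hg : 0 ≤ g) (hd : 0 < d) {L : Finset (Cube N)}
    (hL : ∀ σ, g ^ 2 * nbrCount L σ ≤ d ^ 2 * N) {v : Cube N → ℝ} (hv : 0 ≤ v)
    (s : Finset (Cube N)) (hs : s ⊆ L) :
    expMass (hopping g fun σ => if σ ∈ s then v σ else 0) ≤ 2 ^ N * Real.exp (g * N)
      + ∑ σ ∈ s, v σ * (1 + g / d) ^ 2 * Real.exp (max (v σ) (g * N) + d * N) := by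
  -- Wells enter in order of increasing depth. The new one is the deepest so far, so its own depth
  -- serves in the supersolution, and it costs its own Boltzmann factor instead of that of the
  -- global maximum.
  induction s using Finset.induction_on_max_value v with
  | empty => simpa [Pi.zero_def] using expMass_hopping_zero_le (N := N) hg
  | insert x s hx hmax ih =>
    have hgd : 0 ≤ g / d := by positivity
    rw [Finset.sum_insert hx]
    have h0 : ∀ s : Finset (Cube N), 0 ≤ fun σ => if σ ∈ s then v σ else 0 := by
      intro s σ
      dsimp only
      split_ifs
      exacts [hv σ, le_rfl]
    have key := expMass_add_single_le (A := hopping g fun σ => if σ ∈ insert x s then v σ else 0)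
      (B := hopping g fun σ => if σ ∈ s then v σ else 0) (x := x) (v := v x)
      (φ := fun σ => if σ ∈ L then 1 + g / d else 1) (a := 1 + g / d)
      (E := max (v x) (g * N) + d * N)
      (hopping_nonneg hg (h0 s)) (hopping_isSymm _ _) (hv x) ?_
      (add_nonneg ((hv x).trans (le_max_left _ _)) (by positivity)) ?_ ?_ ?_
    · linarith [ih ((Finset.subset_insert x s).trans hs)]
    · rw [hopping, hopping, add_assoc, diagonal_add]
      congr 2
      ext σ
      by_cases h : σ = x
      · subst h; simp [hx]
      · simp [h]
    · intro σ
      dsimp only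
      split_ifs
      · simpa using hgd
      · exact le_rfl
    · intro σ
      split_ifs
      · exact le_rfl
      · linarith
    · refine hopping_supersolution hg hd hL (fun σ => ?_) fun σ hσ => ?_
      · split_ifs with h
        · rcases Finset.mem_insert.1 h with rfl | h
          · exact le_rfl
          · exact hmax σ h
        · exact hv x
      · rw [if_neg fun h => hσ (hs h)]

/-- Since bG ≤ bεN + b max(G, 0) 1_L, a constant shift costing e^{bεN} leaves only wells on the
sparse set L. The exponential of max(bG, gN) is then split into a sum. -/
theorem expMass_hopping_le {g b d ε C : ℝ} (hg : 0 ≤ g) (hb : 0 ≤ b) (hd : 0 < d) (hε : 0 ≤ ε)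
    (hC : 0 ≤ C) {G : Cube N → ℝ} (hG : ∀ σ, G σ ≤ C * N)
    (hL : ∀ σ, g ^ 2 * nbrCount (Finset.univ.filter fun τ => ε * N < G τ) σ ≤ d ^ 2 * N) :
    expMass (hopping g fun σ => b * G σ) ≤ (1 + b * (C * N) * (1 + g / d) ^ 2)
      * Real.exp ((b * ε + d) * N) * (2 ^ N * Real.exp (g * N) + ∑ σ, Real.exp (b * G σ)) := by
  set L := Finset.univ.filter fun τ => ε * N < G τ with hLdef
  have hεN : 0 ≤ ε * N := by positivity
  have hgd : 0 ≤ g / d := by positivity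
  set K := b * (C * N) * (1 + g / d) ^ 2 with hK
  have hK0 : 0 ≤ K := by positivity
  have h1 := expMass_hopping_le_sum hg hd hL (v := fun σ => b * max (G σ) 0)
    (fun σ => mul_nonneg hb (le_max_right _ _)) L subset_rfl
  have h2 : expMass (hopping g fun σ => b * G σ) ≤ Real.exp (b * (ε * N)) *
      expMass (hopping g fun σ => if σ ∈ L then b * max (G σ) 0 else 0) := by
    rw [← expMass_add_smul_one, ← hopping_add_const]
    refine expMass_mono (hopping_offDiag_nonneg hg _) (hopping_mono fun σ => ?_)
    dsimp only
    split_ifs with h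
    · have := mul_le_mul_of_nonneg_left (le_max_left (G σ) 0) hb
      have := mul_nonneg hb hεN
      linarith
    · rw [zero_add]
      refine mul_le_mul_of_nonneg_left (not_lt.1 fun h' => h ?_) hb
      simpa [hLdef] using h'
  have h3 : ∑ σ ∈ L, b * max (G σ) 0 * (1 + g / d) ^ 2
        * Real.exp (max (b * max (G σ) 0) (g * N) + d * N)
      ≤ ∑ σ : Cube N, K * Real.exp (d * N) * (Real.exp (b * G σ) + Real.exp (g * N)) := by
    refine (Finset.sum_le_sum fun σ hσ => ?_).trans
      (Finset.sum_le_sum_of_subset_of_nonneg (Finset.subset_univ L) fun _ _ _ => by positivity)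
    have hpos : 0 ≤ G σ := hεN.trans (by simpa [hLdef] using hσ : ε * N < G σ).le
    rw [max_eq_left hpos, Real.exp_add, mul_comm (Real.exp _), ← mul_assoc]
    have e1 : b * G σ * (1 + g / d) ^ 2 ≤ K :=
      mul_le_mul_of_nonneg_right (mul_le_mul_of_nonneg_left (hG σ) hb) (by positivity)
    have e2 : Real.exp (max (b * G σ) (g * N)) ≤ Real.exp (b * G σ) + Real.exp (g * N) := by
      rcases max_choice (b * G σ) (g * N) with h | h <;> rw [h]
      · linarith [Real.exp_pos (g * N)]
      · linarith [Real.exp_pos (b * G σ)]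
    exact mul_le_mul (mul_le_mul_of_nonneg_right e1 (Real.exp_pos _).le) e2 (Real.exp_pos _).le
      (by positivity)
  have h4 : ∑ σ : Cube N, K * Real.exp (d * N) * (Real.exp (b * G σ) + Real.exp (g * N))
      = K * Real.exp (d * N) * (2 ^ N * Real.exp (g * N) + ∑ σ, Real.exp (b * G σ)) := by
    rw [← Finset.mul_sum, Finset.sum_add_distrib, Finset.sum_const, Finset.card_univ,
      nsmul_eq_mul, card_cube]
    ring
  set S := 2 ^ N * Real.exp (g * N) + ∑ σ, Real.exp (b * G σ) with hS
  have hS1 : 2 ^ N * Real.exp (g * N) ≤ S :=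
    le_add_of_nonneg_right (Finset.sum_nonneg fun _ _ => (Real.exp_pos _).le)
  have hS0 : 0 ≤ S := le_trans (by positivity) hS1
  have h5 : S ≤ Real.exp (d * N) * S :=
    le_mul_of_one_le_left hS0 (Real.one_le_exp (by positivity))
  calc _ ≤ _ := h2
    _ ≤ Real.exp (b * (ε * N)) * ((1 + K) * Real.exp (d * N) * S) := by
      refine mul_le_mul_of_nonneg_left ?_ (Real.exp_pos _).le
      calc _ ≤ _ := h1
        _ ≤ S + K * Real.exp (d * N) * S := by linarith
        _ ≤ _ := by linarith
    _ = _ := by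
      rw [add_mul (b * ε), Real.exp_add, mul_assoc b]
      ring

theorem sum_exp_le_expMass_hopping {g : ℝ} (hg : 0 ≤ g) (v : Cube N → ℝ) :
    ∑ σ, Real.exp (v σ) ≤ expMass (hopping g v) := by
  rw [← expMass_diagonal]
  refine expMass_mono (fun σ τ h => (diagonal_apply_ne _ h).ge) fun σ τ => ?_
  exact le_add_of_nonneg_left (mul_nonneg hg (adjacency_nonneg σ τ))

/-- The indicator of the complement of L is a subsolution: off L it loses at most ηN neighbours and
a potential bεN, and on L it vanishes. Double counting bounds |L| by η 2^N, so the indicator has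
enough mass. -/
theorem le_expMass_hopping {g b ε η : ℝ} (hg : 0 ≤ g) (hb : 0 ≤ b)
    {G : Cube N → ℝ} (hN : 0 < N)
    (hL : ∀ σ, nbrCount (Finset.univ.filter fun τ => ε * N < -G τ) σ ≤ η * N) :
    (1 - η) * 2 ^ N * Real.exp ((g * (1 - η) - b * ε) * N)
      ≤ expMass (hopping g fun σ => b * G σ) := by
  set L := Finset.univ.filter fun τ => ε * N < -G τ with hLdef
  have hN' : (0 : ℝ) < N := by exact_mod_cast hN
  have hcard : (L.card : ℝ) ≤ η * 2 ^ N := by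
    have h1 : (N : ℝ) * L.card = ∑ σ, (nbrCount L σ : ℝ) := by
      exact_mod_cast (sum_nbrCount L).symm
    have h2 : ∑ σ, (nbrCount L σ : ℝ) ≤ ∑ _σ : Cube N, η * N :=
      Finset.sum_le_sum fun σ _ => hL σ
    rw [Finset.sum_const, Finset.card_univ, nsmul_eq_mul, card_cube, ← h1] at h2
    refine le_of_mul_le_mul_left ?_ hN'
    linarith
  set φ : Cube N → ℝ := fun σ => if σ ∈ L then 0 else 1 with hφ
  have hsub : ((g * (1 - η) - b * ε) * N) • φ ≤ hopping g (fun σ => b * G σ) *ᵥ φ := by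
    intro σ
    rw [hopping_mulVec, hφ, sum_nbr_ite, Pi.smul_apply, smul_eq_mul]
    beta_reduce
    have h1 := mul_le_mul_of_nonneg_left (hL σ) hg
    have h0 : (nbrCount L σ : ℝ) ≤ N := by
      have := Finset.card_le_univ (Finset.univ.filter fun i => flip σ i ∈ L)
      rw [Fintype.card_fin] at this
      exact_mod_cast this
    split_ifs with h
    · have := mul_le_mul_of_nonneg_left h0 hg
      linarith
    · have h2 : -G σ ≤ ε * N := not_lt.1 fun h' => h (by simpa [hLdef] using h')
      have h3 := mul_le_mul_of_nonneg_left h2 hb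
      linarith
  have h1 := le_exp_mulVec (hopping_offDiag_nonneg hg _) hsub
  have h2 : ∀ σ, (NormedSpace.exp (hopping g fun σ => b * G σ) *ᵥ φ) σ
      ≤ (NormedSpace.exp (hopping g fun σ => b * G σ) *ᵥ 1) σ := by
    refine mulVec_mono (fun σ τ => ?_) fun σ => ?_
    -- Entries of the exponential are nonnegative by comparison with its explicit diagonal part.
    · have h := exp_apply_mono (A := diagonal fun σ => b * G σ)
        (fun σ τ h => (diagonal_apply_ne _ h).ge) (fun σ τ =>
          (le_add_of_nonneg_left (mul_nonneg hg (adjacency_nonneg σ τ)) :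
            _ ≤ hopping g (fun σ => b * G σ) σ τ)) σ τ
      refine le_trans ?_ h
      rw [exp_diagonal, diagonal_apply]
      split_ifs
      · rw [Pi.coe_exp, ← Real.exp_eq_exp_ℝ]
        exact (Real.exp_pos _).le
      · exact le_rfl
    · simp only [hφ]
      split_ifs <;> simp
  have h3 : ∑ σ, Real.exp ((g * (1 - η) - b * ε) * N) * φ σ
      ≤ expMass (hopping g fun σ => b * G σ) :=
    Finset.sum_le_sum fun σ _ => (h1 σ).trans (h2 σ)
  refine le_trans ?_ h3
  rw [← Finset.mul_sum, mul_comm]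
  refine mul_le_mul_of_nonneg_left ?_ (Real.exp_pos _).le
  have h4 : ∑ σ, φ σ = 2 ^ N - L.card := by
    have : ∀ σ, φ σ = 1 - if σ ∈ L then 1 else 0 := by
      intro σ; simp only [hφ]; split_ifs <;> norm_num
    simp only [this, Finset.sum_sub_distrib]
    rw [Finset.sum_ite_mem, Finset.univ_inter]
    simp
  rw [h4]
  linarith

theorem Z_eq (U : Cube N → ℝ) (t lam s : ℝ) :
    Z N U t lam s = Real.exp (-(t * N)) * ((2 ^ N)⁻¹ *
      expMass (hopping (t * Real.exp (-s)) fun σ => t * lam * -U σ)) := by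
  have h1 : t • generator N U lam s
      = hopping (t * Real.exp (-s)) (fun σ => t * lam * -U σ)
        + (-(t * N)) • (1 : Matrix (Cube N) (Cube N) ℝ) := by
    ext σ τ
    by_cases h : σ = τ
    · subst h
      simp [generator, hopping]
      ring
    · simp [generator, hopping, h]
      ring
  have h2 : flat N = (Real.sqrt (2 ^ N))⁻¹ • (1 : Cube N → ℝ) := by
    ext σ
    simp [flat]
  have h3 : (Real.sqrt (2 ^ N))⁻¹ * (Real.sqrt (2 ^ N))⁻¹ = ((2 : ℝ) ^ N)⁻¹ := by
    rw [← mul_inv, Real.mul_self_sqrt (by positivity)]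
  rw [Z, h1, exp_add_smul_one, h2, mulVec_smul, dotProduct_smul, smul_dotProduct, smul_mulVec,
    dotProduct_smul, one_dotProduct, ← h3]
  simp only [smul_eq_mul, expMass]
  ring

end Cube

theorem eventually_mul_le_exp (C : ℝ) {ε : ℝ} (hε : 0 < ε) :
    ∀ᶠ N : ℕ in atTop, C * (N + 1) ≤ Real.exp (ε * N) := by
  -- The threshold makes 2|C|N at most (εN)²/2, the quadratic term of the exponential series.
  filter_upwards [(tendsto_natCast_atTop_atTop (R := ℝ)).eventually_ge_atTop (4 * |C| / ε ^ 2),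
    eventually_ge_atTop 1] with N h1 h2
  have h2' : (1 : ℝ) ≤ N := by exact_mod_cast h2
  rw [div_le_iff₀ (by positivity)] at h1
  have h3 := Real.quadratic_le_exp_of_nonneg (x := ε * N) (by positivity)
  have h4 : 0 ≤ ε * N := by positivity
  have h5 : 4 * |C| * N ≤ N * ε ^ 2 * N := mul_le_mul_of_nonneg_right h1 (by linarith)
  have h6 : C * (N + 1) ≤ |C| * (N + N) :=
    (mul_le_mul_of_nonneg_right (le_abs_self C) (by linarith)).trans
      (mul_le_mul_of_nonneg_left (by linarith) (abs_nonneg C))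
  nlinarith

variable {Ω : Type*} [MeasurableSpace Ω] {P : Measure Ω}

/-! ### Borel–Cantelli and Gaussian tails. -/

section Gaussian

/-- The first Borel–Cantelli lemma, which needs no independence; hence the joint law for different N
is irrelevant. -/
theorem ae_eventually_notMem_of_le_exp [IsFiniteMeasure P] {A : ℕ → Set Ω} {c : ℝ} (C : ℝ)
    (hc : 0 < c) (h : ∀ᶠ N : ℕ in atTop, P.real (A N) ≤ C * Real.exp (-(c * N))) :
    ∀ᵐ ω ∂P, ∀ᶠ N in atTop, ω ∉ A N := by
  have hs : Summable fun N : ℕ => C * Real.exp (-(c * N)) := by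
    have := (Real.summable_exp_nat_mul_iff.2 (neg_lt_zero.2 hc)).mul_left C
    refine this.congr fun N => ?_
    congr 2
    ring
  have hs' : Summable fun N => P.real (A N) := by
    refine summable_of_isBigO_nat hs (Asymptotics.IsBigO.of_bound 1 ?_)
    filter_upwards [h] with N hN
    rw [Real.norm_of_nonneg measureReal_nonneg, one_mul]
    exact hN.trans (le_abs_self _)
  refine ae_eventually_notMem ?_
  have := hs'.tsum_ofReal_ne_top
  simpa [ofReal_measureReal] using this

theorem integrable_exp_mul {N : ℕ} {X : Ω → ℝ} (hX : HasLaw X (gaussianReal 0 (N : NNReal)) P)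
    (b : ℝ) : Integrable (fun ω => Real.exp (b * X ω)) P := by
  have h := integrable_exp_mul_gaussianReal (μ := 0) (v := (N : NNReal)) b
  rw [← hX.map_eq] at h
  exact h.comp_aemeasurable hX.aemeasurable

/-- Chernoff bound with the optimal tilt E. -/
theorem gaussian_tail_le [IsProbabilityMeasure P] {N : ℕ} {X : Ω → ℝ}
    (hX : HasLaw X (gaussianReal 0 (N : NNReal)) P) {E : ℝ} (hE : 0 ≤ E) :
    P.real {ω | E * N ≤ X ω} ≤ Real.exp (-(E ^ 2 / 2 * N)) := by
  have hmgf := mgf_gaussianReal hX.map_eq E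
  refine (measure_ge_le_exp_mul_mgf (E * N) hE (integrable_exp_mul hX E)).trans_eq ?_
  rw [hmgf, ← Real.exp_add]
  congr 1
  simp
  ring

/-- The density is integrated over the unit interval [EN, EN + 1] only; there the normalisation and
the bounded change of exponent are absorbed by e^{εN}. -/
theorem eventually_exp_le_gaussianReal_Ici {E ε : ℝ} (hE : 0 ≤ E) (hε : 0 < ε) :
    ∀ᶠ N : ℕ in atTop, Real.exp (-((E ^ 2 / 2 + ε) * N))
      ≤ (gaussianReal 0 (N : NNReal)).real (Set.Ici (E * N)) := by
  filter_upwards [eventually_mul_le_exp (2 * Real.pi * Real.exp (E + 1)) hε,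
    eventually_ge_atTop 1] with N hN h1
  have h1' : (1 : ℝ) ≤ N := by exact_mod_cast h1
  have hN0 : (N : NNReal) ≠ 0 := by exact_mod_cast (by omega : N ≠ 0)
  have hNpos : (0 : ℝ) < N := by linarith
  have hpi := Real.pi_gt_three
  set q := Real.exp (-((E ^ 2 / 2 + ε) * N)) with hq
  have hpdf : ∀ x ∈ Set.Icc (E * N) (E * N + 1), q ≤ gaussianPDFReal 0 (N : NNReal) x := by
    intro x hx
    have hx0 : 0 ≤ x := le_trans (by positivity) hx.1
    have hsq : x ^ 2 ≤ (E * N + 1) ^ 2 := pow_le_pow_left₀ hx0 hx.2 2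
    have hA : 0 < Real.sqrt (2 * Real.pi * N) := Real.sqrt_pos.2 (by positivity)
    have hsqrt : Real.sqrt (2 * Real.pi * N) ≤ 2 * Real.pi * N := by
      rw [Real.sqrt_le_left (by positivity)]
      have : 1 ≤ 2 * Real.pi * N := by nlinarith
      nlinarith
    have hexp : -((E ^ 2 / 2) * N + E + 1) ≤ -(x - 0) ^ 2 / (2 * N) := by
      rw [le_div_iff₀ (by positivity), sub_zero]
      nlinarith
    have hmain : q * (2 * Real.pi * N) ≤ Real.exp (-((E ^ 2 / 2) * N + E + 1)) := by
      have e1 : Real.exp (-((E ^ 2 / 2) * N + E + 1))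
          = q * (Real.exp (ε * N) * Real.exp (-(E + 1))) := by
        rw [hq, ← Real.exp_add, ← Real.exp_add]
        congr 1
        ring
      rw [e1]
      refine mul_le_mul_of_nonneg_left ?_ (Real.exp_pos _).le
      rw [Real.exp_neg, ← div_eq_mul_inv, le_div_iff₀ (Real.exp_pos _)]
      refine le_trans ?_ hN
      have : 0 < 2 * Real.pi * Real.exp (E + 1) := by positivity
      nlinarith
    rw [gaussianPDFReal]
    simp only [NNReal.coe_natCast]
    rw [inv_mul_eq_div, le_div_iff₀ hA]
    calc q * Real.sqrt (2 * Real.pi * N) ≤ q * (2 * Real.pi * N) :=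
          mul_le_mul_of_nonneg_left hsqrt (Real.exp_pos _).le
      _ ≤ _ := hmain
      _ ≤ _ := Real.exp_le_exp.2 hexp
  calc q = ∫ _ in Set.Icc (E * N) (E * N + 1), q := by simp
    _ ≤ ∫ x in Set.Icc (E * N) (E * N + 1), gaussianPDFReal 0 (N : NNReal) x :=
        setIntegral_mono_on (by simp) (integrable_gaussianPDFReal _ _).integrableOn
          measurableSet_Icc hpdf
    _ = (gaussianReal 0 (N : NNReal)).real (Set.Icc (E * N) (E * N + 1)) := by
        rw [measureReal_def, gaussianReal_apply_eq_integral _ hN0, ENNReal.toReal_ofReal]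
        exact integral_nonneg fun x => gaussianPDFReal_nonneg _ _ _
    _ ≤ _ := measureReal_mono Set.Icc_subset_Ici_self

end Gaussian

/-! ### The classical random energy model. -/

theorem betaC_pos : 0 < betaC := Real.sqrt_pos.2 (by have := Real.log_pos one_lt_two; linarith)

theorem betaC_sq : betaC ^ 2 = 2 * Real.log 2 :=
  Real.sq_sqrt (by have := Real.log_pos one_lt_two; linarith)

theorem two_pow_eq_exp (N : ℕ) : (2 : ℝ) ^ N = Real.exp (Real.log 2 * N) := by
  rw [mul_comm, Real.exp_nat_mul, Real.exp_log two_pos]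

section REM

theorem IsREM.neg {N : ℕ} {U : Cube N → Ω → ℝ} (h : IsREM P N U) :
    IsREM P N fun σ ω => -U σ ω := by
  refine ⟨fun σ => ?_, ?_⟩
  · simpa using! gaussianReal_neg (h.hasLaw σ)
  · exact h.indep.comp (fun _ x => -x) fun _ => measurable_neg

variable [IsProbabilityMeasure P] {G : (N : ℕ) → Cube N → Ω → ℝ}

/-- Almost surely, eventually no configuration exceeds the level `C N`, if `C` lies above the
critical level. -/
theorem ae_eventually_le (hG : ∀ N, IsREM P N (G N)) {C : ℝ} (hC : betaC < C) :
    ∀ᵐ ω ∂P, ∀ᶠ N : ℕ in atTop, ∀ σ, G N σ ω ≤ C * N := by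
  have hC0 : 0 < C := betaC_pos.trans hC
  have hc : 0 < C ^ 2 / 2 - Real.log 2 := by
    have := betaC_sq
    have := pow_lt_pow_left₀ hC betaC_pos.le two_ne_zero
    linarith
  have h := ae_eventually_notMem_of_le_exp (P := P)
    (A := fun N => ⋃ σ, {ω | C * N ≤ G N σ ω}) 1 hc (Eventually.of_forall fun N => ?_)
  · filter_upwards [h] with ω hω
    filter_upwards [hω] with N hN σ
    simp only [Set.mem_iUnion, Set.mem_ofPred_eq, not_exists, not_le] at hN
    exact (hN σ).le
  · calc P.real (⋃ σ, {ω | C * N ≤ G N σ ω}) ≤ ∑ σ, P.real {ω | C * N ≤ G N σ ω} :=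
          measureReal_iUnion_fintype_le _
      _ ≤ ∑ _σ : Cube N, Real.exp (-(C ^ 2 / 2 * N)) :=
          Finset.sum_le_sum fun σ _ => gaussian_tail_le ((hG N).hasLaw σ) hC0.le
      _ = 1 * Real.exp (-((C ^ 2 / 2 - Real.log 2) * N)) := by
          rw [Finset.sum_const, Finset.card_univ, nsmul_eq_mul, card_cube, two_pow_eq_exp,
            ← Real.exp_add, one_mul]
          congr 1
          ring

/-- Flips in distinct directions are distinct configurations, so the tail probabilities multiply. -/
theorem measureReal_nbrs_le {N : ℕ} {G : Cube N → Ω → ℝ} (hG : IsREM P N G) {ε : ℝ} (hε : 0 ≤ ε)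
    (σ : Cube N) (S : Finset (Fin N)) :
    P.real (⋂ i ∈ S, {ω | ε * N < G (flip σ i) ω})
      ≤ Real.exp (-(ε ^ 2 / 2 * N)) ^ S.card := by
  have h := (hG.indep.precomp (flip_injective σ)).measure_inter_preimage_eq_mul S
    (sets := fun _ => Set.Ioi (ε * N)) fun _ _ => measurableSet_Ioi
  have h' : P.real (⋂ i ∈ S, {ω | ε * N < G (flip σ i) ω})
      = ∏ i ∈ S, P.real {ω | ε * N < G (flip σ i) ω} := by
    rw [measureReal_def]
    simp only [measureReal_def, ← ENNReal.toReal_prod]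
    exact congrArg ENNReal.toReal h
  rw [h', ← Finset.prod_const]
  refine Finset.prod_le_prod (fun _ _ => measureReal_nonneg) fun i _ => ?_
  have hsub : {ω | ε * N < G (flip σ i) ω} ⊆ {ω | ε * N ≤ G (flip σ i) ω} :=
    fun ω (hω : ε * N < G (flip σ i) ω) => hω.le
  exact (measureReal_mono hsub).trans (gaussian_tail_le (hG.hasLaw (flip σ i)) hε)

/-- Almost surely, eventually every configuration has at most `η N` neighbours above the level
`ε N`. -/
theorem ae_eventually_nbrCount_le (hG : ∀ N, IsREM P N (G N)) {ε η : ℝ} (hε : 0 < ε)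
    (hη : 0 < η) : ∀ᵐ ω ∂P, ∀ᶠ N : ℕ in atTop, ∀ σ,
      (nbrCount (Finset.univ.filter fun τ => ε * N < G N τ ω) σ : ℝ) ≤ η * N := by
  classical
  -- Union bound over the centre and over all sets of more than ηN directions.
  have h := ae_eventually_notMem_of_le_exp (P := P)
    (A := fun N => ⋃ p : Cube N × {S : Finset (Fin N) // η * N < S.card},
      ⋂ i ∈ p.2.1, {ω | ε * N < G N (flip p.1 i) ω}) 1 one_pos ?_
  · filter_upwards [h] with ω hω
    filter_upwards [hω] with N hN σ
    by_contra hc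
    refine hN (Set.mem_iUnion.2 ⟨(σ, ⟨_, not_le.1 hc⟩), ?_⟩)
    simp
  -- The exponent is quadratic in N, so it eventually beats the entropy 2N ln 2 with a margin N.
  · have hev : ∀ᶠ N : ℕ in atTop, 2 * Real.log 2 + 1 ≤ ε ^ 2 / 2 * η * N :=
      ((tendsto_natCast_atTop_atTop (R := ℝ)).const_mul_atTop
        (by positivity : 0 < ε ^ 2 / 2 * η)).eventually_ge_atTop _
    filter_upwards [hev] with N hN
    calc _ ≤ ∑ p : Cube N × {S : Finset (Fin N) // η * N < S.card},
          P.real (⋂ i ∈ p.2.1, {ω | ε * N < G N (flip p.1 i) ω}) :=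
          measureReal_iUnion_fintype_le _
      _ ≤ ∑ _p : Cube N × {S : Finset (Fin N) // η * N < S.card},
          Real.exp (-((2 * Real.log 2 + 1) * N)) := by
        refine Finset.sum_le_sum fun p _ => (measureReal_nbrs_le (hG N) hε.le p.1 p.2.1).trans ?_
        rw [← Real.exp_nat_mul, Real.exp_le_exp]
        have h1 : ε ^ 2 / 2 * N * (η * N) ≤ ε ^ 2 / 2 * N * p.2.1.card :=
          mul_le_mul_of_nonneg_left p.2.2.le (by positivity)
        have h2 := mul_le_mul_of_nonneg_right hN (Nat.cast_nonneg (α := ℝ) N)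
        linarith
      _ ≤ (2 ^ N * 2 ^ N) * Real.exp (-((2 * Real.log 2 + 1) * N)) := by
        rw [Finset.sum_const, Finset.card_univ, nsmul_eq_mul, Fintype.card_prod, Nat.cast_mul,
          card_cube]
        refine mul_le_mul_of_nonneg_right (mul_le_mul_of_nonneg_left ?_ (by positivity))
          (Real.exp_pos _).le
        have := Fintype.card_subtype_le fun S : Finset (Fin N) => η * N < S.card
        rw [Fintype.card_finset, Fintype.card_fin] at this
        exact_mod_cast this
      _ = 1 * Real.exp (-(1 * N)) := by
        rw [two_pow_eq_exp, ← Real.exp_add, ← Real.exp_add, one_mul]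
        congr 1
        ring

/-- Markov's inequality for the exact first moment. -/
theorem ae_eventually_sum_exp_le_annealed (hG : ∀ N, IsREM P N (G N)) (b : ℝ) {ε : ℝ}
    (hε : 0 < ε) : ∀ᵐ ω ∂P, ∀ᶠ N : ℕ in atTop,
      ∑ σ, Real.exp (b * G N σ ω) ≤ 2 ^ N * Real.exp ((b ^ 2 / 2 + ε) * N) := by
  have h := ae_eventually_notMem_of_le_exp (P := P) (A := fun N =>
    {ω | 2 ^ N * Real.exp ((b ^ 2 / 2 + ε) * N) ≤ ∑ σ, Real.exp (b * G N σ ω)}) 1 hε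
    (Eventually.of_forall fun N => ?_)
  · filter_upwards [h] with ω hω
    filter_upwards [hω] with N hN
    exact (not_le.1 hN).le
  · have hint : ∀ σ, Integrable (fun ω => Real.exp (b * G N σ ω)) P := fun σ =>
      integrable_exp_mul ((hG N).hasLaw σ) b
    have hM := mul_meas_ge_le_integral_of_nonneg (μ := P)
      (f := fun ω => ∑ σ, Real.exp (b * G N σ ω))
      (Eventually.of_forall fun ω => Finset.sum_nonneg fun _ _ => (Real.exp_pos _).le)
      (integrable_finsetSum _ fun σ _ => hint σ) (2 ^ N * Real.exp ((b ^ 2 / 2 + ε) * N))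
    have hI : ∫ ω, ∑ σ, Real.exp (b * G N σ ω) ∂P = 2 ^ N * Real.exp (b ^ 2 / 2 * N) := by
      rw [integral_finsetSum _ fun σ _ => hint σ]
      have : ∀ σ, ∫ ω, Real.exp (b * G N σ ω) ∂P = Real.exp (b ^ 2 / 2 * N) := by
        intro σ
        have := mgf_gaussianReal ((hG N).hasLaw σ).map_eq b
        rw [mgf] at this
        rw [this]
        congr 1
        simp
        ring
      simp only [this, Finset.sum_const, Finset.card_univ, nsmul_eq_mul, card_cube]
    rw [hI] at hM
    rw [one_mul]
    refine le_of_mul_le_mul_left (hM.trans_eq ?_)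
      (by positivity : 0 < (2 : ℝ) ^ N * Real.exp ((b ^ 2 / 2 + ε) * N))
    rw [mul_assoc, ← Real.exp_add]
    congr 2
    ring

/-- Beyond β_c the first moment is too large. The annealed bound is used at β_c, and the remaining
factor e^{(b - β_c)G} is bounded through the maximum of G. -/
theorem ae_eventually_sum_exp_le (hG : ∀ N, IsREM P N (G N)) (b : ℝ) {ε : ℝ}
    (hε : 0 < ε) : ∀ᵐ ω ∂P, ∀ᶠ N : ℕ in atTop,
      ∑ σ, Real.exp (b * G N σ ω) ≤ 2 ^ N * Real.exp ((pREM b + ε) * N) := by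
  by_cases hb : b ≤ betaC
  · simpa only [pREM, if_pos hb] using ae_eventually_sum_exp_le_annealed hG b hε
  · rw [not_le] at hb
    have hδ : 0 < ε / (2 * (b - betaC)) := div_pos hε (by linarith)
    filter_upwards [ae_eventually_sum_exp_le_annealed hG betaC (half_pos hε),
      ae_eventually_le hG (lt_add_of_pos_right betaC hδ)] with ω h1 h2
    filter_upwards [h1, h2] with N h1 h2
    have hmul : (b - betaC) * (ε / (2 * (b - betaC))) = ε / 2 := by
      have : b - betaC ≠ 0 := by linarith
      field_simp
    calc ∑ σ, Real.exp (b * G N σ ω)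
        ≤ ∑ σ, Real.exp (betaC * G N σ ω)
          * Real.exp ((b - betaC) * ((betaC + ε / (2 * (b - betaC))) * N)) := by
          refine Finset.sum_le_sum fun σ _ => ?_
          rw [← Real.exp_add, Real.exp_le_exp]
          have := mul_le_mul_of_nonneg_left (h2 σ) (by linarith : 0 ≤ b - betaC)
          linarith
      _ ≤ 2 ^ N * Real.exp ((betaC ^ 2 / 2 + ε / 2) * N)
          * Real.exp ((b - betaC) * ((betaC + ε / (2 * (b - betaC))) * N)) := by
          rw [← Finset.sum_mul]
          exact mul_le_mul_of_nonneg_right h1 (Real.exp_pos _).le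
      _ = _ := by
          rw [mul_assoc, ← Real.exp_add, pREM, if_neg (not_le.2 hb), ← mul_assoc (b - betaC),
            mul_add (b - betaC), hmul]
          congr 2
          linear_combination (-(N : ℝ) / 2) * betaC_sq

/-- Almost surely, eventually the level set above `E N` has the expected exponential size. -/
theorem ae_eventually_le_card (hG : ∀ N, IsREM P N (G N)) {E ε : ℝ} (hE : 0 ≤ E)
    (hEc : E < betaC) (hε : 0 < ε) : ∀ᵐ ω ∂P, ∀ᶠ N : ℕ in atTop,
      2 ^ N * Real.exp (-((E ^ 2 / 2 + ε) * N))
        ≤ ((Finset.univ.filter fun σ => E * N ≤ G N σ ω).card : ℝ) := by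
  -- Half the entropy gap: with tail error `c`, the expected size of the level set is still at least
  -- e^{cN}, which makes the Chebyshev bound summable.
  set c := (Real.log 2 - E ^ 2 / 2) / 2 with hc
  have hc0 : 0 < c := by
    have := betaC_sq
    have := pow_lt_pow_left₀ hEc hE two_ne_zero
    linarith
  set p : ℕ → ℝ := fun N => (gaussianReal 0 (N : NNReal)).real (Set.Ici (E * N)) with hp
  set S : ℕ → Ω → ℝ := fun N ω =>
    ((Finset.univ.filter fun σ => E * N ≤ G N σ ω).card : ℝ) with hS
  have h := ae_eventually_notMem_of_le_exp (P := P) (A := fun N =>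
    {ω | 2 ^ N * p N / 2 ≤ |S N ω - 2 ^ N * p N|}) 4 hc0 ?_
  · filter_upwards [h] with ω hω
    filter_upwards [hω, eventually_exp_le_gaussianReal_Ici hE (half_pos hε),
      eventually_mul_le_exp 2 (half_pos hε)] with N h1 h2 h3
    replace h1 := abs_lt.1 (not_le.1 h1)
    have h4 : Real.exp (-((E ^ 2 / 2 + ε) * N)) * 2 ≤ p N := by
      refine le_trans ?_ h2
      have h5 : (2 : ℝ) ≤ Real.exp (ε / 2 * N) := le_trans (by norm_num) h3
      calc _ ≤ Real.exp (-((E ^ 2 / 2 + ε) * N)) * Real.exp (ε / 2 * N) :=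
            mul_le_mul_of_nonneg_left h5 (Real.exp_pos _).le
        _ = _ := by rw [← Real.exp_add]; congr 1; ring
    have h6 := mul_le_mul_of_nonneg_left h4 (by positivity : (0 : ℝ) ≤ 2 ^ N)
    change _ ≤ S N ω
    linarith [h1.1]
  · filter_upwards [eventually_exp_le_gaussianReal_Ici hE hc0] with N hN
    have hp0 : 0 < p N := (Real.exp_pos _).trans_le hN
    set X : Cube N → Ω → ℝ := fun σ ω => (Set.Ici (E * N)).indicator 1 (G N σ ω) with hX
    have hXm : ∀ σ, AEStronglyMeasurable (X σ) P := fun σ =>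
      ((measurable_one.indicator measurableSet_Ici).comp_aemeasurable
        ((hG N).hasLaw σ).aemeasurable).aestronglyMeasurable
    have hX01 : ∀ σ ω, X σ ω ^ 2 = X σ ω ∧ ‖X σ ω‖ ≤ 1 := by
      intro σ ω
      simp only [hX, Set.indicator_apply]
      split_ifs <;> simp
    have hX2 : ∀ σ, MemLp (X σ) 2 P := fun σ =>
      MemLp.of_bound (hXm σ) 1 (Eventually.of_forall fun ω => (hX01 σ ω).2)
    have hXint : ∀ σ, ∫ ω, X σ ω ∂P = p N := by
      intro σ
      have h1 := ((hG N).hasLaw σ).integral_comp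
        (f := (Set.Ici (E * N)).indicator (1 : ℝ → ℝ))
        (measurable_one.indicator measurableSet_Ici).aestronglyMeasurable
      rw [integral_indicator_one measurableSet_Ici] at h1
      exact h1
    have hSX : S N = ∑ σ, X σ := by
      ext ω
      simp only [hS, hX, Finset.sum_apply, Set.indicator_apply, Set.mem_Ici, Pi.one_apply]
      rw [Finset.sum_boole]
    have hSint : ∫ ω, S N ω ∂P = 2 ^ N * p N := by
      simp only [hSX, Finset.sum_apply]
      rw [integral_finsetSum _ fun σ _ => (hX2 σ).integrable one_le_two]
      simp [hXint]
    -- Indicators equal their squares and are pairwise independent, so the variance is at most the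
    -- mean.
    have hvar : variance (S N) P ≤ 2 ^ N * p N := by
      rw [hSX, IndepFun.variance_sum (fun σ _ => hX2 σ) fun σ _ τ _ hστ =>
        ((hG N).indep.indepFun hστ).comp (measurable_one.indicator measurableSet_Ici)
          (measurable_one.indicator measurableSet_Ici)]
      calc ∑ σ, variance (X σ) P ≤ ∑ _σ : Cube N, p N := by
            refine Finset.sum_le_sum fun σ _ => (variance_le_expectation_sq (hXm σ)).trans_eq ?_
            rw [← hXint σ]
            exact integral_congr_ae (Eventually.of_forall fun ω => (hX01 σ ω).1)
        _ = _ := by rw [Finset.sum_const, Finset.card_univ, nsmul_eq_mul, card_cube]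
    have hSm : MemLp (S N) 2 P := by
      rw [hSX]
      exact memLp_finsetSum' _ fun σ _ => hX2 σ
    have hm : 0 < 2 ^ N * p N := by positivity
    have hcheb := meas_ge_le_variance_div_sq hSm (half_pos hm)
    rw [hSint] at hcheb
    calc P.real {ω | 2 ^ N * p N / 2 ≤ |S N ω - 2 ^ N * p N|}
        ≤ variance (S N) P / (2 ^ N * p N / 2) ^ 2 :=
          ENNReal.toReal_le_of_le_ofReal (div_nonneg (variance_nonneg _ _) (sq_nonneg _)) hcheb
      _ ≤ 2 ^ N * p N / (2 ^ N * p N / 2) ^ 2 := by gcongr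
      _ = 4 * (2 ^ N * p N)⁻¹ := by field_simp; norm_num
      _ ≤ 4 * Real.exp (-(c * N)) := by
        rw [Real.exp_neg]
        gcongr
        rw [two_pow_eq_exp]
        calc Real.exp (c * N)
            = Real.exp (Real.log 2 * N) * Real.exp (-((E ^ 2 / 2 + c) * N)) := by
              rw [← Real.exp_add]
              congr 1
              rw [hc]
              ring
          _ ≤ _ := mul_le_mul_of_nonneg_left hN (Real.exp_pos _).le

/-- Legendre duality: the pressure is the supremum of bE - E²/2 over 0 ≤ E < β_c. For b ≥ β_c it is
only approached as E ↑ β_c, whence the loss ε. -/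
theorem exists_lt_betaC_pREM_lt {b ε : ℝ} (hb : 0 ≤ b) (hε : 0 < ε) :
    ∃ E, 0 ≤ E ∧ E < betaC ∧ pREM b - ε < b * E - E ^ 2 / 2 := by
  rcases lt_or_ge b betaC with h | h
  · refine ⟨b, hb, h, ?_⟩
    rw [pREM, if_pos h.le]
    linarith
  · have hp : pREM b = b * betaC - betaC ^ 2 / 2 := by
      rw [pREM]
      split_ifs with h'
      · rw [le_antisymm h' h]; ring
      · rw [betaC_sq]; ring
    have hcont : Continuous fun E : ℝ => b * E - E ^ 2 / 2 := by fun_prop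
    have h1 : ∀ᶠ E in 𝓝[<] betaC, pREM b - ε < b * E - E ^ 2 / 2 :=
      nhdsWithin_le_nhds ((hcont.tendsto betaC).eventually (lt_mem_nhds (by rw [hp]; linarith)))
    have h2 : ∀ᶠ E in 𝓝[<] betaC, E ∈ Set.Ioo 0 betaC := Ioo_mem_nhdsLT betaC_pos
    obtain ⟨E, hE1, hE2⟩ := (h1.and h2).exists
    exact ⟨E, hE2.1.le, hE2.2, hE1⟩

theorem ae_eventually_le_sum_exp (hG : ∀ N, IsREM P N (G N)) {b ε : ℝ} (hb : 0 ≤ b)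
    (hε : 0 < ε) : ∀ᵐ ω ∂P, ∀ᶠ N : ℕ in atTop,
      2 ^ N * Real.exp ((pREM b - ε) * N) ≤ ∑ σ, Real.exp (b * G N σ ω) := by
  obtain ⟨E, hE0, hEc, hE⟩ := exists_lt_betaC_pREM_lt hb (half_pos hε)
  filter_upwards [ae_eventually_le_card hG hE0 hEc (half_pos hε)] with ω hω
  filter_upwards [hω] with N hN
  calc 2 ^ N * Real.exp ((pREM b - ε) * N)
      ≤ 2 ^ N * Real.exp (-((E ^ 2 / 2 + ε / 2) * N)) * Real.exp (b * (E * N)) := by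
        rw [mul_assoc, ← Real.exp_add]
        gcongr
        have := mul_le_mul_of_nonneg_right hE.le (Nat.cast_nonneg (α := ℝ) N)
        linarith
    _ ≤ (Finset.univ.filter fun σ => E * N ≤ G N σ ω).card * Real.exp (b * (E * N)) :=
        mul_le_mul_of_nonneg_right hN (Real.exp_pos _).le
    _ = ∑ σ with E * N ≤ G N σ ω, Real.exp (b * (E * N)) := by
        rw [Finset.sum_const, nsmul_eq_mul]
    _ ≤ ∑ σ with E * N ≤ G N σ ω, Real.exp (b * G N σ ω) := by
        refine Finset.sum_le_sum fun σ hσ => ?_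
        rw [Finset.mem_filter_univ] at hσ
        gcongr
    _ ≤ _ := Finset.sum_le_sum_of_subset_of_nonneg (Finset.filter_subset _ _)
        fun _ _ _ => (Real.exp_pos _).le

end REM

/-! ### Almost sure asymptotics of the quantum partition function. -/

section FreeEnergy

variable {Ω : Type*} [MeasurableSpace Ω] {P : Measure Ω} [IsProbabilityMeasure P]
  {G : (N : ℕ) → Cube N → Ω → ℝ}

theorem ae_eventually_expMass_le (hG : ∀ N, IsREM P N (G N)) {g b ε : ℝ} (hg : 0 < g)
    (hb : 0 ≤ b) (hε : 0 < ε) : ∀ᵐ ω ∂P, ∀ᶠ N : ℕ in atTop,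
      expMass (hopping g fun σ => b * G N σ ω)
        ≤ 2 ^ N * Real.exp ((max g (pREM b) + ε) * N) := by
  -- The budget is four quarters of ε: the level cutoff bε', the supersolution surplus, the
  -- classical sum and the polynomial prefactor. Using b + 1 in ε' allows b = 0.
  set d := ε / 4 with hd
  have hd0 : 0 < d := by positivity
  set ε' := ε / (4 * (b + 1)) with hε'
  have hε'0 : 0 < ε' := by positivity
  have hbε : b * ε' ≤ ε / 4 := by
    have : (b + 1) * ε' = ε / 4 := by rw [hε']; field_simp
    linarith
  set C := betaC + 1 with hC
  have hC0 : 0 < C := by linarith [betaC_pos]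
  set A := 2 * (1 + b * C * (1 + g / d) ^ 2) with hA
  filter_upwards [ae_eventually_sum_exp_le hG b hd0, ae_eventually_le hG (lt_add_one betaC),
    ae_eventually_nbrCount_le hG hε'0 (by positivity : 0 < d ^ 2 / g ^ 2)] with ω h1 h2 h3
  filter_upwards [h1, h2, h3, eventually_mul_le_exp A hd0] with N h1 h2 h3 h4
  set m := max g (pREM b) with hm
  have h5 := expMass_hopping_le hg.le hb hd0 hε'0.le hC0.le h2 fun σ => by
    have := mul_le_mul_of_nonneg_left (h3 σ) (sq_nonneg g)
    refine this.trans_eq ?_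
    field_simp
  have h6 : 2 ^ N * Real.exp (g * N) + ∑ σ, Real.exp (b * G N σ ω)
      ≤ 2 * (2 ^ N * Real.exp ((m + d) * N)) := by
    have e1 : Real.exp (g * N) ≤ Real.exp ((m + d) * N) := by
      gcongr
      linarith [le_max_left g (pREM b)]
    have e2 : Real.exp ((pREM b + d) * N) ≤ Real.exp ((m + d) * N) := by
      gcongr
      exact le_max_right g (pREM b)
    have e3 := mul_le_mul_of_nonneg_left e1 (by positivity : (0 : ℝ) ≤ 2 ^ N)
    have e4 := mul_le_mul_of_nonneg_left e2 (by positivity : (0 : ℝ) ≤ 2 ^ N)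
    linarith
  have h7 : 2 * (1 + b * (C * N) * (1 + g / d) ^ 2) ≤ Real.exp (d * N) := by
    refine le_trans ?_ h4
    have : 0 ≤ b * C * (1 + g / d) ^ 2 := by positivity
    have hN0 : (0 : ℝ) ≤ N := by positivity
    rw [hA]
    linarith
  calc _ ≤ _ := h5
    _ ≤ (1 + b * (C * N) * (1 + g / d) ^ 2) * Real.exp ((b * ε' + d) * N)
        * (2 * (2 ^ N * Real.exp ((m + d) * N))) :=
        mul_le_mul_of_nonneg_left h6 (by positivity)
    _ = 2 * (1 + b * (C * N) * (1 + g / d) ^ 2)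
        * (2 ^ N * Real.exp ((b * ε' + d) * N + (m + d) * N)) := by
        rw [Real.exp_add]
        ring
    _ ≤ Real.exp (d * N) * (2 ^ N * Real.exp ((b * ε' + d) * N + (m + d) * N)) :=
        mul_le_mul_of_nonneg_right h7 (by positivity)
    _ = 2 ^ N * Real.exp ((m + (b * ε' + 3 * d)) * N) := by
        rw [mul_left_comm, ← Real.exp_add]
        congr 2
        ring
    _ ≤ _ := by
        gcongr
        linarith

theorem ae_eventually_le_expMass_of_hopping (hG : ∀ N, IsREM P N (G N)) {g b ε : ℝ} (hg : 0 < g)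
    (hb : 0 ≤ b) (hε : 0 < ε) : ∀ᵐ ω ∂P, ∀ᶠ N : ℕ in atTop,
      2 ^ N * Real.exp ((g - ε) * N) ≤ expMass (hopping g fun σ => b * G N σ ω) := by
  -- This gives both η ≤ 1/2, so that e^{εN/2} absorbs the prefactor 1 - η, and gη ≤ ε/4.
  set η := ε / (4 * g + 2 * ε) with hη
  have hη0 : 0 < η := by positivity
  have hη1 : η * (4 * g + 2 * ε) = ε := by rw [hη]; field_simp
  have hη2 : η ≤ 1 / 2 := by nlinarith [mul_pos hη0 hg]
  have hη3 : g * η ≤ ε / 4 := by nlinarith [mul_pos hη0 hε]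
  set ε' := ε / (4 * (b + 1)) with hε'
  have hε'0 : 0 < ε' := by positivity
  have hbε : b * ε' ≤ ε / 4 := by
    have : (b + 1) * ε' = ε / 4 := by rw [hε']; field_simp
    linarith
  filter_upwards [ae_eventually_nbrCount_le (fun N => (hG N).neg) hε'0 hη0] with ω h1
  filter_upwards [h1, eventually_mul_le_exp 2 (half_pos hε), eventually_gt_atTop 0]
    with N h1 h2 h3
  have h4 := le_expMass_hopping hg.le hb h3 h1
  refine le_trans ?_ h4
  have h5 : 2 ≤ Real.exp (ε / 2 * N) := le_trans (by linarith [Nat.cast_nonneg (α := ℝ) N]) h2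
  have h6 : 1 ≤ (1 - η) * Real.exp (ε / 2 * N) := by nlinarith
  calc 2 ^ N * Real.exp ((g - ε) * N)
      ≤ 2 ^ N * Real.exp ((g - ε) * N) * ((1 - η) * Real.exp (ε / 2 * N)) :=
        le_mul_of_one_le_right (by positivity) h6
    _ = (1 - η) * 2 ^ N * Real.exp ((g - ε / 2) * N) := by
        have : (g - ε / 2) * N = (g - ε) * N + ε / 2 * N := by ring
        rw [this, Real.exp_add]
        ring
    _ ≤ _ := by
        have : 0 ≤ (1 - η) * 2 ^ N := mul_nonneg (by linarith) (by positivity)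
        refine mul_le_mul_of_nonneg_left (Real.exp_le_exp.2
          (mul_le_mul_of_nonneg_right ?_ (Nat.cast_nonneg N))) this
        linarith

theorem ae_eventually_le_expMass (hG : ∀ N, IsREM P N (G N)) {g b ε : ℝ} (hg : 0 < g)
    (hb : 0 ≤ b) (hε : 0 < ε) : ∀ᵐ ω ∂P, ∀ᶠ N : ℕ in atTop,
      2 ^ N * Real.exp ((max g (pREM b) - ε) * N)
        ≤ expMass (hopping g fun σ => b * G N σ ω) := by
  rcases max_choice g (pREM b) with h | h <;> rw [h]
  · exact ae_eventually_le_expMass_of_hopping hG hg hb hε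
  · filter_upwards [ae_eventually_le_sum_exp hG hb hε] with ω hω
    filter_upwards [hω] with N hN
    exact hN.trans (sum_exp_le_expMass_hopping hg.le _)

/-- The free energy of the quantum random energy model in the flat state. -/
theorem ae_tendsto_log_expMass (hG : ∀ N, IsREM P N (G N)) {g b : ℝ} (hg : 0 < g)
    (hb : 0 ≤ b) : ∀ᵐ ω ∂P, Tendsto (fun N : ℕ =>
      Real.log ((2 ^ N)⁻¹ * expMass (hopping g fun σ => b * G N σ ω)) / N) atTop
      (𝓝 (max g (pREM b))) := by
  -- Errors 1/(k + 1) suffice and keep the exceptional null sets countable.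
  have hpos : ∀ k : ℕ, (0 : ℝ) < 1 / ((k : ℝ) + 1) := fun k => Nat.one_div_pos_of_nat
  have hup := ae_all_iff.2 fun k : ℕ => ae_eventually_expMass_le hG hg hb (hpos k)
  have hlow := ae_all_iff.2 fun k : ℕ => ae_eventually_le_expMass hG hg hb (hpos k)
  filter_upwards [hup, hlow] with ω hup hlow
  rw [Metric.tendsto_nhds]
  intro ε hε
  obtain ⟨k, hk⟩ := exists_nat_one_div_lt hε
  filter_upwards [hup k, hlow k, eventually_gt_atTop 0] with N h1 h2 h3
  have hN : (0 : ℝ) < N := by exact_mod_cast h3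
  have h2N : (0 : ℝ) < 2 ^ N := by positivity
  rw [← le_inv_mul_iff₀ h2N] at h2
  rw [← inv_mul_le_iff₀ h2N] at h1
  have hM := (Real.exp_pos _).trans_le h2
  rw [← Real.le_log_iff_exp_le hM] at h2
  rw [← Real.log_le_iff_le_exp hM] at h1
  rw [← le_div_iff₀ hN] at h2
  rw [← div_le_iff₀ hN] at h1
  rw [Real.dist_eq, abs_lt]
  constructor <;> linarith

end FreeEnergy

end REMTrajectory

theorem theorem1p1 {Ω : Type*} [MeasurableSpace Ω] (P : Measure Ω) [IsProbabilityMeasure P]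
    (U : (N : ℕ) → REMTrajectory.Cube N → Ω → ℝ)
    (hU : ∀ N, REMTrajectory.IsREM P N (U N))
    (t lam s : ℝ) (ht : 0 < t) (hlam : 0 ≤ lam) :
    ∀ᵐ ω ∂P, Tendsto (fun N : ℕ => REMTrajectory.scgf N (fun σ => U N σ ω) t lam s) atTop
      (𝓝 (max (Real.exp (-s)) (t⁻¹ * REMTrajectory.pREM (t * lam)) - 1)) := by
  have hg : 0 < t * Real.exp (-s) := mul_pos ht (Real.exp_pos _)
  filter_upwards [REMTrajectory.ae_tendsto_log_expMass (fun N => (hU N).neg) hg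
    (mul_nonneg ht.le hlam)] with ω hω
  have hlim := (hω.const_mul t⁻¹).sub_const 1
  rw [mul_max_of_nonneg _ _ (inv_nonneg.2 ht.le), inv_mul_cancel_left₀ ht.ne'] at hlim
  refine hlim.congr' ?_
  filter_upwards [eventually_gt_atTop 0] with N hN
  have hN' : (N : ℝ) ≠ 0 := by exact_mod_cast hN.ne'
  have hpos : 0 < (2 ^ N : ℝ)⁻¹ * REMTrajectory.expMass
      (REMTrajectory.hopping (t * Real.exp (-s)) fun σ => t * lam * -U N σ ω) :=
    mul_pos (by positivity) ((Finset.sum_pos (fun σ _ => Real.exp_pos _)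
      Finset.univ_nonempty).trans_le (REMTrajectory.sum_exp_le_expMass_hopping hg.le _))
  rw [REMTrajectory.scgf, REMTrajectory.Z_eq, Real.log_mul (Real.exp_pos _).ne' hpos.ne',
    Real.log_exp]
  field_simp
  ring
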